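/- Let $d\in\mathbb N$, $\sigma>0$, let $k=\mathcal N(0,\sigma^2 I)$ be the centred Gaussian distribution on $\mathbb R^d$, and let $\tilde q$ be a probability distribution on $\mathbb R^d$ (for instance one with an energy-based density $e^{-f(x)}/Z$). For a finite Borel measure $\mu$ on $\mathbb R^d$ write $\mathcal F(\mu)(\xi)=\int e^{-2\pi i\langle x,\xi\rangle}\,d\mu(x)$; this is the usual Fourier transform of the density if $\mu$ has one. A continuous function $g:\mathbb R^d\to\mathbb C$ is called positive semi-definite if for all $n\in\mathbb N$, all pairwise distinct $x_1,\dots,x_n\in\mathbb R^d$ and all $\alpha\in\mathbb C^n$ the sum $\sum_{i=1}^n\sum_{j=1}^n\alpha_i\overline{\alpha_j}\,g(x_i-x_j)$ is real and $\ge 0$. Then there exists a probability distribution $q$ on $\mathbb R^d$ (the underlying clean model) with $q*k=\tilde q$ if and only if the function $\mathcal F(\tilde q)/\mathcal F(k)$ is positive semi-definite. Moreover, every probability distribution $q$ with $q*k=\tilde q$ is given by $$q=\mathcal F^{-1}\bigl(\mathcal F(\tilde q)/\mathcal F(k)\bigr),$$ where $\mathcal F(\tilde q)/\mathcal F(k)$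 is then a bounded function and $\mathcal F^{-1}$ is the inverse Fourier transform of tempered distributions. -/

import Mathlib

open MeasureTheory ProbabilityTheory
open scoped ComplexOrder FourierTransform SchwartzMap ENNReal

/-- A function `f : ℝᵈ → ℂ` is positive semi-definite if it is continuous and, for all `n`, all
pairwise distinct `x₁, …, xₙ ∈ ℝᵈ` and all `α ∈ ℂⁿ`, the number
`∑ᵢ ∑ⱼ αᵢ * conj αⱼ * f (xᵢ - xⱼ)` is real and non-negative (this is what `0 ≤` means in `ℂ`). -/
structure IsPositiveSemidefinite {d : ℕ} (f : EuclideanSpace ℝ (Fin d) → ℂ) : Prop where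
  continuous : Continuous f
  nonneg : ∀ (n : ℕ) (x : Fin n → EuclideanSpace ℝ (Fin d)), Function.Injective x →
    ∀ α : Fin n → ℂ, 0 ≤ ∑ i, ∑ j, α i * star (α j) * f (x i - x j)

/-- The Fourier transform `ξ ↦ ∫ exp (-2πi ⟨x, ξ⟩) dμ(x)` of a finite measure on `ℝᵈ`. If `μ` has
a density `p`, this is the Fourier transform `𝓕 p`. -/
noncomputable def measureFourier {d : ℕ} (μ : Measure (EuclideanSpace ℝ (Fin d)))
    (ξ : EuclideanSpace ℝ (Fin d)) : ℂ :=
  ∫ x, Complex.exp (-2 * Real.pi * Complex.I * (inner ℝ x ξ : ℝ)) ∂μ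

/-- The Gaussian noise distribution `N(0, σ² I)` on `ℝᵈ`. -/
noncomputable def gaussianNoise (d : ℕ) (σ : ℝ) : Measure (EuclideanSpace ℝ (Fin d)) :=
  multivariateGaussian 0 (σ ^ 2 • (1 : Matrix (Fin d) (Fin d) ℝ))

/-- The quotient `𝓕(qt) / 𝓕(k)`, where `k = N(0, σ² I)`. -/
noncomputable def fourierRatio {d : ℕ} (qt : Measure (EuclideanSpace ℝ (Fin d))) (σ : ℝ)
    (ξ : EuclideanSpace ℝ (Fin d)) : ℂ :=
  measureFourier qt ξ / measureFourier (gaussianNoise d σ) ξ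

/-- `q = 𝓕⁻¹ g`: the function `g` is (essentially bounded, hence) a tempered distribution, and
the measure `q`, as a tempered distribution, is the inverse Fourier transform of `g`. -/
def IsInverseFourier {d : ℕ} (q : Measure (EuclideanSpace ℝ (Fin d))) [q.HasTemperateGrowth]
    (g : EuclideanSpace ℝ (Fin d) → ℂ) : Prop :=
  ∃ hg : MemLp g ∞ (volume : Measure (EuclideanSpace ℝ (Fin d))),
    q.toTemperedDistribution = 𝓕⁻ (Lp.toTemperedDistribution (hg.toLp g))

/-! The Fourier transform of the Gaussian `k` never vanishes and turns convolution into a product,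
so `q * k = q̃` holds exactly when `q` has Fourier transform `fourierRatio`. The equivalence is then
Bochner's theorem, and the formula for `q` is duality with Schwartz functions.

The hard half of Bochner tests `f` on independent random points, which makes the average of `f (x -
y)` under `μ × μ` non-negative. For Gaussian `μ`, and with `f` twisted by characters, this says that
a Gaussian times `f` has non-negative Fourier transform. Gaussian-regularized inversion exhibits
that product as a limit of characteristic functions. A second limit removes the Gaussian; both
limits use Lévy continuity (`exists_charFun_eq_of_tendsto`). -/

open Filter Topology

/-! ### Positive semi-definite functions: bounds, twists, averages -/

namespace IsPositiveSemidefinite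

variable {d : ℕ} {f : EuclideanSpace ℝ (Fin d) → ℂ}

/-- The points in the definition of positive semi-definiteness need not be distinct. -/
theorem sum_nonneg (hf : IsPositiveSemidefinite f) {n : ℕ} (x : Fin n → EuclideanSpace ℝ (Fin d))
    (α : Fin n → ℂ) : 0 ≤ ∑ i, ∑ j, α i * star (α j) * f (x i - x j) := by
  classical
  obtain ⟨m, y, hy, g, hg⟩ : ∃ (m : ℕ) (y : Fin m → EuclideanSpace ℝ (Fin d)),
      Function.Injective y ∧ ∃ g : Fin n → Fin m, ∀ i, x i = y (g i) := by
    let s := Finset.univ.image x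
    refine ⟨s.card, fun k ↦ (s.equivFin.symm k : EuclideanSpace ℝ (Fin d)),
      Subtype.val_injective.comp s.equivFin.symm.injective,
      fun i ↦ s.equivFin ⟨x i, Finset.mem_image_of_mem x (Finset.mem_univ i)⟩, fun i ↦ by simp⟩
  refine (hf.nonneg m y hy fun k ↦ ∑ i with g i = k, α i).trans_eq ?_
  simp_rw [hg, star_sum, Finset.sum_mul_sum, Finset.sum_mul]
  rw [← Finset.sum_fiberwise (s := Finset.univ) (g := g)]
  refine Finset.sum_congr rfl fun k _ ↦ ?_
  rw [Finset.sum_comm]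
  refine Finset.sum_congr rfl fun i hi ↦ ?_
  rw [← Finset.sum_fiberwise (s := Finset.univ) (g := g)]
  refine Finset.sum_congr rfl fun l _ ↦ Finset.sum_congr rfl fun j hj ↦ ?_
  rw [(Finset.mem_filter.1 hi).2, (Finset.mem_filter.1 hj).2]

theorem zero_nonneg (hf : IsPositiveSemidefinite f) : 0 ≤ f 0 := by
  simpa using hf.sum_nonneg (n := 1) 0 1

theorem norm_le (hf : IsPositiveSemidefinite f) (x : EuclideanSpace ℝ (Fin d)) :
    ‖f x‖ ≤ (f 0).re := by
  have key (a b : ℂ) := hf.sum_nonneg ![x, 0] ![a, b]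
  simp only [Fin.sum_univ_two, Matrix.cons_val_zero, Matrix.cons_val_one, sub_self, sub_zero,
    zero_sub] at key
  have h0 := Complex.nonneg_iff.1 hf.zero_nonneg
  have h1 := (Complex.nonneg_iff.1 (key 1 1)).2
  have h2 := (Complex.nonneg_iff.1 (key 1 Complex.I)).2
  simp at h1 h2
  -- The weights `(1, 1)` and `(1, I)` force `f (-x) = conj (f x)`. With these new weights the form
  -- equals `2‖f x‖² (f 0 - ‖f x‖)`.
  have h3 := (Complex.nonneg_iff.1 (key ‖f x‖ (-f x))).1
  have hn : ‖f x‖ ^ 2 = (f x).re ^ 2 + (f x).im ^ 2 := by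
    rw [Complex.sq_norm, Complex.normSq_apply]; ring
  have hre : (f (-x)).re = (f x).re := by linarith
  have him : (f (-x)).im = -(f x).im := by linarith
  simp [hre, him] at h3
  rcases (norm_nonneg (f x)).eq_or_lt with h | h
  · rw [← h]; exact h0.1
  · have : 0 ≤ 2 * ‖f x‖ ^ 2 * ((f 0).re - ‖f x‖) := by
      rw [← h0.2] at h3
      nlinarith
    have := nonneg_of_mul_nonneg_right this (by positivity)
    linarith

theorem exp_inner_mul (hf : IsPositiveSemidefinite f) (c : ℝ) (w : EuclideanSpace ℝ (Fin d)) :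
    IsPositiveSemidefinite fun x ↦ Complex.exp (c * inner ℝ x w * Complex.I) * f x where
  continuous := by have := hf.continuous; fun_prop
  nonneg n x _ α := by
    refine (hf.sum_nonneg x fun i ↦ α i * Complex.exp (c * inner ℝ (x i) w * Complex.I)).trans_eq ?_
    refine Finset.sum_congr rfl fun i _ ↦ Finset.sum_congr rfl fun j _ ↦ ?_
    have : Complex.exp (c * inner ℝ (x i - x j) w * Complex.I)
        = Complex.exp (c * inner ℝ (x i) w * Complex.I)
          * star (Complex.exp (c * inner ℝ (x j) w * Complex.I)) := by
      rw [Complex.star_def, ← Complex.exp_conj, ← Complex.exp_add, inner_sub_left]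
      congr 1
      simp
      ring
    rw [this, star_mul']
    ring

theorem integrable_comp (hf : IsPositiveSemidefinite f) {X : Type*} [MeasurableSpace X]
    {P : Measure X} [IsFiniteMeasure P] {g : X → EuclideanSpace ℝ (Fin d)} (hg : Measurable g) :
    Integrable (fun ω ↦ f (g ω)) P :=
  .of_bound (hf.continuous.measurable.comp hg).aestronglyMeasurable (f 0).re
    (ae_of_all _ fun _ ↦ hf.norm_le _)

/-- Take the expectation of the quadratic form at `n + 1` independent samples of `μ`: the diagonal
contributes order `n`, the off-diagonal terms order `n²` times the integral, which therefore cannot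
be negative. -/
theorem integral_prod_sub_nonneg (hf : IsPositiveSemidefinite f)
    (μ : Measure (EuclideanSpace ℝ (Fin d))) [IsProbabilityMeasure μ] :
    0 ≤ ∫ z, f (z.1 - z.2) ∂(μ.prod μ) := by
  set J := ∫ z, f (z.1 - z.2) ∂(μ.prod μ) with hJ
  have key (n : ℕ) : 0 ≤ ((n : ℂ) + 1) * f 0 + ((n : ℂ) + 1) * n * J := by
    let P := Measure.pi fun _ : Fin (n + 1) ↦ μ
    have hpair (i j : Fin (n + 1)) :
        ∫ ω, f (ω i - ω j) ∂P = if i = j then f 0 else J := by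
      split_ifs with h
      · simp [h]
      · have hind : IndepFun (fun ω : Fin (n + 1) → EuclideanSpace ℝ (Fin d) ↦ ω i)
            (fun ω ↦ ω j) P :=
          (iIndepFun_pi (μ := fun _ : Fin (n + 1) ↦ μ) (X := fun _ x ↦ x)
            (fun _ ↦ aemeasurable_id)).indepFun h
        rw [indepFun_iff_map_prod_eq_prod_map_map (measurable_pi_apply i).aemeasurable
            (measurable_pi_apply j).aemeasurable,
          (measurePreserving_eval _ i).map_eq, (measurePreserving_eval _ j).map_eq] at hind
        rw [hJ, ← hind, integral_map (by fun_prop)]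
        exact (hf.continuous.comp (by fun_prop)).aestronglyMeasurable
    have hsum : 0 ≤ ∫ ω, ∑ i, ∑ j, f (ω i - ω j) ∂P :=
      integral_nonneg fun ω ↦ by simpa using hf.sum_nonneg ω 1
    have hint (i j : Fin (n + 1)) : Integrable (fun ω ↦ f (ω i - ω j)) P :=
      hf.integrable_comp (by fun_prop)
    rw [integral_finsetSum _ fun i _ ↦ integrable_finsetSum _ fun j _ ↦ hint i j] at hsum
    simp_rw [integral_finsetSum _ fun j _ ↦ hint _ j, hpair] at hsum
    refine hsum.trans_eq ?_
    have hi (i : Fin (n + 1)) : ∑ j, (if i = j then f 0 else J) = f 0 + n * J := by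
      have (j : Fin (n + 1)) : (if i = j then f 0 else J) = (if i = j then f 0 - J else 0) + J := by
        split_ifs <;> ring
      simp_rw [this, Finset.sum_add_distrib]
      simp
      ring
    simp_rw [hi]
    simp
    ring
  have h0 := Complex.nonneg_iff.1 hf.zero_nonneg
  have him : J.im = 0 := by
    have := (Complex.nonneg_iff.1 (key 1)).2
    simp [← h0.2] at this
    linarith
  refine Complex.nonneg_iff.2 ⟨?_, him.symm⟩
  by_contra! hneg
  obtain ⟨n, hn⟩ := exists_nat_gt ((f 0).re / -J.re)
  rw [div_lt_iff₀ (by linarith)] at hn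
  have := (Complex.nonneg_iff.1 (key n)).1
  simp [him, ← h0.2] at this
  nlinarith

end IsPositiveSemidefinite

/-! ### Lévy continuity and Gaussian weights -/

/-- If the characteristic functions of probability measures converge pointwise to a function that
is continuous at `0`, then this function is the characteristic function of a probability measure. -/
theorem exists_charFun_eq_of_tendsto {E : Type*} [NormedAddCommGroup E] [InnerProductSpace ℝ E]
    [FiniteDimensional ℝ E] [MeasurableSpace E] [BorelSpace E] (μ : ℕ → Measure E)
    [hμ : ∀ n, IsProbabilityMeasure (μ n)] {f : E → ℂ} (hf : ContinuousAt f 0)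
    (h : ∀ t, Tendsto (fun n ↦ charFun (μ n) t) atTop (𝓝 (f t))) :
    ∃ ν : Measure E, IsProbabilityMeasure ν ∧ charFun ν = f := by
  let P : ℕ → ProbabilityMeasure E := fun n ↦ ⟨μ n, hμ n⟩
  have htight : IsTightMeasureSet {((ρ : ProbabilityMeasure E) : Measure E) | ρ ∈ Set.range P} := by
    convert isTightMeasureSet_of_tendsto_charFun hf h using 1
    ext ρ
    exact ⟨fun ⟨_, ⟨n, hn⟩, hρ⟩ ↦ ⟨n, hρ ▸ hn ▸ rfl⟩, fun ⟨n, hn⟩ ↦ ⟨P n, ⟨n, rfl⟩, hn⟩⟩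
  -- Prokhorov compactness; a limit along an ultrafilter replaces the extraction of a subsequence.
  obtain ⟨ν, -, hν⟩ := (isCompact_closure_of_isTightMeasureSet htight).ultrafilter_le_nhds
    ((hyperfilter ℕ).map P) (.trans (by simp) (monotone_principal subset_closure))
  have hν' : Tendsto P (hyperfilter ℕ) (𝓝 ν) := hν
  refine ⟨ν, inferInstance, funext fun t ↦ ?_⟩
  rw [ProbabilityMeasure.tendsto_iff_forall_integral_rclike_tendsto ℂ] at hν'
  have h1 := hν' (BoundedContinuousFunction.innerProbChar t)
  simp_rw [← charFun_eq_integral_innerProbChar] at h1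
  exact tendsto_nhds_unique h1 ((h t).mono_left (Nat.hyperfilter_le_atTop))

/-- A non-negative integrable function with non-zero integral is, up to normalization, the density
of a probability measure. -/
theorem exists_isProbabilityMeasure_integral_eq {X : Type*} [MeasurableSpace X] {m : Measure X}
    {w : X → ℝ} (hw : Measurable w) (hw0 : ∀ x, 0 ≤ w x) (hwi : Integrable w m)
    (hZ : ∫ x, w x ∂m ≠ 0) :
    ∃ μ : Measure X, IsProbabilityMeasure μ ∧
      ∀ g : X → ℂ, ∫ x, g x ∂μ = ((∫ x, w x ∂m : ℝ) : ℂ)⁻¹ * ∫ x, w x * g x ∂m := by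
  set Z := ∫ x, w x ∂m with hZdef
  have hZ0 : 0 ≤ Z := integral_nonneg hw0
  refine ⟨m.withDensity fun x ↦ ENNReal.ofReal (Z⁻¹ * w x), ⟨?_⟩, fun g ↦ ?_⟩
  · rw [withDensity_apply _ .univ, Measure.restrict_univ, ← ofReal_integral_eq_lintegral_ofReal
      (hwi.const_mul _) (ae_of_all _ fun x ↦ by have := hw0 x; positivity), integral_const_mul,
      ← hZdef, inv_mul_cancel₀ hZ, ENNReal.ofReal_one]
  · rw [integral_withDensity_eq_integral_toReal_smul (by fun_prop)
      (ae_of_all _ fun _ ↦ ENNReal.ofReal_lt_top), ← integral_const_mul]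
    refine integral_congr_ae (ae_of_all _ fun x ↦ ?_)
    have := hw0 x
    simp only [ENNReal.toReal_ofReal (show 0 ≤ Z⁻¹ * w x by positivity), Complex.real_smul]
    push_cast
    ring

theorem integrable_exp_neg_mul_sq_norm {V : Type*} [NormedAddCommGroup V] [InnerProductSpace ℝ V]
    [FiniteDimensional ℝ V] [MeasurableSpace V] [BorelSpace V] {b : ℝ} (hb : 0 < b) :
    Integrable fun v : V ↦ Real.exp (-b * ‖v‖ ^ 2) := by
  have := (GaussianFourier.integrable_cexp_neg_mul_sq_norm_add (V := V) (b := (b : ℂ)) (by simpa)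
    0 0).re
  refine this.congr (ae_of_all _ fun v ↦ ?_)
  simp only [zero_mul, add_zero]
  norm_cast

theorem integral_exp_neg_mul_sq_norm_pos {V : Type*} [NormedAddCommGroup V] [InnerProductSpace ℝ V]
    [FiniteDimensional ℝ V] [MeasurableSpace V] [BorelSpace V] {b : ℝ} (hb : 0 < b) :
    0 < ∫ v : V, Real.exp (-b * ‖v‖ ^ 2) := by
  rw [GaussianFourier.integral_rexp_neg_mul_sq_norm hb]
  positivity

/-! ### Testing against Gaussians -/

namespace IsPositiveSemidefinite

variable {d : ℕ} {f : EuclideanSpace ℝ (Fin d) → ℂ}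

theorem integrable_gaussian_mul (hf : IsPositiveSemidefinite f) {b : ℝ} (hb : 0 < b) :
    Integrable fun u ↦ (Real.exp (-b * ‖u‖ ^ 2) : ℂ) * f u :=
  (integrable_exp_neg_mul_sq_norm hb).ofReal.mul_bdd (c := (f 0).re)
    hf.continuous.aestronglyMeasurable (ae_of_all _ hf.norm_le)

theorem integral_gaussian_mul_nonneg (hf : IsPositiveSemidefinite f) {b : ℝ} (hb : 0 < b) :
    0 ≤ ∫ u, (Real.exp (-b * ‖u‖ ^ 2) : ℂ) * f u := by
  -- Rate `2b`, because the autocorrelation of this Gaussian is a multiple of the one with rate `b`;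
  -- `hw` completes the square.
  let w : EuclideanSpace ℝ (Fin d) → ℝ := fun u ↦ Real.exp (-(2 * b) * ‖u‖ ^ 2)
  have hwi : Integrable w := integrable_exp_neg_mul_sq_norm (by positivity)
  have hZ : 0 < ∫ u, w u := integral_exp_neg_mul_sq_norm_pos (by positivity)
  obtain ⟨μ, _, hμ⟩ := exists_isProbabilityMeasure_integral_eq (w := w) (by fun_prop)
    (fun u ↦ (Real.exp_pos _).le) hwi hZ.ne'
  have h := hf.integral_prod_sub_nonneg μ
  rw [integral_prod _ (hf.integrable_comp (by fun_prop))] at h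
  simp_rw [hμ] at h
  have hprod : Integrable (fun z : EuclideanSpace ℝ (Fin d) × EuclideanSpace ℝ (Fin d) ↦
      (w z.1 : ℂ) * w z.2 * f (z.1 - z.2)) (volume.prod volume) :=
    (hwi.ofReal.mul_prod hwi.ofReal).mul_bdd (c := (f 0).re)
      (hf.continuous.comp (by fun_prop)).aestronglyMeasurable (ae_of_all _ fun _ ↦ hf.norm_le _)
  have hmp := measurePreserving_add_prod (volume : Measure (EuclideanSpace ℝ (Fin d)))
    (volume : Measure (EuclideanSpace ℝ (Fin d)))
  have hint := hmp.integrable_comp_of_integrable hprod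
  have hchange : ∫ z, (w z.1 : ℂ) * w z.2 * f (z.1 - z.2) ∂(volume.prod volume) =
      ∫ z : EuclideanSpace ℝ (Fin d) × EuclideanSpace ℝ (Fin d),
        (w (z.1 + z.2) : ℂ) * w z.2 * f z.1 ∂(volume.prod volume) := by
    conv_lhs => rw [← hmp.map_eq]
    rw [integral_map hmp.aemeasurable (by rw [hmp.map_eq]; exact hprod.aestronglyMeasurable)]
    simp
  have hw (u v : EuclideanSpace ℝ (Fin d)) : w (u + v) * w v =
      Real.exp (-b * ‖u‖ ^ 2) * Real.exp (-(4 * b) * ‖v + (1 / 2 : ℝ) • u‖ ^ 2) := by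
    simp only [w, ← Real.exp_add, norm_add_sq_real, norm_smul, inner_smul_right,
      real_inner_comm u v]
    congr 1
    norm_num
    ring
  have hC : 0 < ∫ v : EuclideanSpace ℝ (Fin d), Real.exp (-(4 * b) * ‖v‖ ^ 2) :=
    integral_exp_neg_mul_sq_norm_pos (by positivity)
  have hinner (u : EuclideanSpace ℝ (Fin d)) : ∫ v, (w (u + v) : ℂ) * w v * f u =
      ((∫ v : EuclideanSpace ℝ (Fin d), Real.exp (-(4 * b) * ‖v‖ ^ 2) : ℝ) : ℂ) *
        (Real.exp (-b * ‖u‖ ^ 2) * f u) := by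
    rw [← integral_add_right_eq_self (fun v ↦ Real.exp (-(4 * b) * ‖v‖ ^ 2)) ((1 / 2 : ℝ) • u),
      ← integral_complex_ofReal, ← integral_mul_const]
    congr with v
    rw [← Complex.ofReal_mul, hw]
    push_cast
    ring
  have heq : ∫ x, (w x : ℂ) * ∫ y, (w y : ℂ) * f (x - y) =
      ((∫ v : EuclideanSpace ℝ (Fin d), Real.exp (-(4 * b) * ‖v‖ ^ 2) : ℝ) : ℂ) *
        ∫ u, (Real.exp (-b * ‖u‖ ^ 2) : ℂ) * f u := by
    calc _ = ∫ x, ∫ y, (w x : ℂ) * w y * f (x - y) := by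
          simp_rw [mul_assoc, integral_const_mul]
      _ = ∫ z, (w z.1 : ℂ) * w z.2 * f (z.1 - z.2) ∂(volume.prod volume) :=
          (integral_prod _ hprod).symm
      _ = _ := by
          rw [hchange, integral_prod _ (by simpa [Function.comp_def] using hint)]
          simp_rw [hinner, integral_const_mul]
  simp_rw [mul_left_comm _ ((∫ u, w u : ℝ) : ℂ)⁻¹, integral_const_mul, heq] at h
  have hpos {r : ℝ} (hr : 0 < r) {z : ℂ} (hz : 0 ≤ (r : ℂ) * z) : 0 ≤ z := by
    rw [Complex.nonneg_iff] at hz ⊢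
    simp only [Complex.re_ofReal_mul, Complex.im_ofReal_mul] at hz
    exact ⟨nonneg_of_mul_nonneg_right hz.1 hr, by
      simpa [hr.ne', eq_comm] using hz.2⟩
  rw [← Complex.ofReal_inv] at h
  exact hpos hC (hpos (inv_pos.2 hZ) (hpos (inv_pos.2 hZ) h))

end IsPositiveSemidefinite

/-! ### Bochner's theorem -/

namespace IsPositiveSemidefinite

variable {d : ℕ} {f : EuclideanSpace ℝ (Fin d) → ℂ}

theorem comp_smul (hf : IsPositiveSemidefinite f) (c : ℝ) :
    IsPositiveSemidefinite fun x ↦ f (c • x) where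
  continuous := hf.continuous.comp (by fun_prop)
  nonneg n x _ α := by simpa [smul_sub] using hf.sum_nonneg (fun i ↦ c • x i) α

/-- The Fourier character is absorbed into `f`, which stays positive semi-definite. -/
theorem fourier_gaussian_mul_nonneg (hf : IsPositiveSemidefinite f) {b : ℝ} (hb : 0 < b)
    (w : EuclideanSpace ℝ (Fin d)) :
    0 ≤ 𝓕 (fun u ↦ (Real.exp (-b * ‖u‖ ^ 2) : ℂ) * f u) w := by
  rw [Real.fourier_eq']
  refine ((hf.exp_inner_mul (-2 * Real.pi) w).integral_gaussian_mul_nonneg hb).trans_eq ?_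
  congr with u
  push_cast
  rw [smul_eq_mul]
  ring_nf

/-- An integrable continuous function with non-negative Fourier transform is, up to scaling, the
characteristic function of a probability measure. -/
theorem _root_.exists_charFun_eq_of_fourier_nonneg {F : EuclideanSpace ℝ (Fin d) → ℂ}
    (hF : Continuous F) (hFi : Integrable F) (hF0 : F 0 = 1) (hpos : ∀ w, 0 ≤ 𝓕 F w) :
    ∃ ν : Measure (EuclideanSpace ℝ (Fin d)), IsProbabilityMeasure ν ∧
      ∀ t, charFun ν t = F ((2 * Real.pi)⁻¹ • t) := by
  -- Inversion integral damped by a Gaussian, since `𝓕 F` is not known to be integrable.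
  let A (c : ℝ) (v : EuclideanSpace ℝ (Fin d)) : ℂ := ∫ w : EuclideanSpace ℝ (Fin d),
    Complex.exp (-c⁻¹ * ‖w‖ ^ 2 + 2 * Real.pi * Complex.I * inner ℝ v w) * 𝓕 F w
  have hA (v : EuclideanSpace ℝ (Fin d)) : Tendsto (fun c ↦ A c v) atTop (𝓝 (F v)) := by
    refine (Real.tendsto_integral_gaussian_smul' hFi hF.continuousAt).congr' ?_
    filter_upwards [Ioi_mem_atTop 0] with c (hc : 0 < c)
    have J : Integrable (fun w : EuclideanSpace ℝ (Fin d) ↦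
        Complex.exp (-c⁻¹ * ‖w‖ ^ 2 + 2 * Real.pi * Complex.I * inner ℝ v w)) :=
      GaussianFourier.integrable_cexp_neg_mul_sq_norm_add (by simpa) _ _
    have h := VectorFourier.integral_fourierIntegral_smul_eq_flip
      (L := innerₗ (EuclideanSpace ℝ (Fin d))) Real.continuous_fourierChar continuous_inner J hFi
    rw [flip_innerₗ] at h
    refine Eq.trans ?_ h
    congr with w
    change _ = 𝓕 (fun w : EuclideanSpace ℝ (Fin d) ↦
        Complex.exp (-c⁻¹ * ‖w‖ ^ 2 + 2 * Real.pi * Complex.I * inner ℝ v w)) w • F w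
    have h1 : (Real.pi : ℂ) / ((c⁻¹ : ℝ) : ℂ) = Real.pi * c := by simp
    have h2 : -(Real.pi : ℂ) ^ 2 * ‖v - w‖ ^ 2 / ((c⁻¹ : ℝ) : ℂ) =
        -Real.pi ^ 2 * c * ‖v - w‖ ^ 2 := by simp; ring
    rw [fourier_gaussian_innerProductSpace' (by simpa), h1, h2]
  have hP : Continuous (𝓕 F) := VectorFourier.fourierIntegral_continuous
    Real.continuous_fourierChar continuous_inner hFi
  have hPre (w : EuclideanSpace ℝ (Fin d)) : ((𝓕 F w).re : ℂ) = 𝓕 F w := by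
    have := (Complex.nonneg_iff.1 (hpos w)).2
    apply Complex.ext <;> simp [← this]
  obtain ⟨N, hN⟩ : ∃ N : ℕ, ∀ n ≥ N, A n 0 ≠ 0 := by
    have := ((hA 0).comp tendsto_natCast_atTop_atTop).eventually_ne (hF0 ▸ one_ne_zero)
    exact eventually_atTop.1 this
  -- The shift by `N` keeps the normalizing constant `A (c n) 0` non-zero; the extra `1` keeps `c n`
  -- positive.
  let c (n : ℕ) : ℝ := ((n + (N + 1) : ℕ) : ℝ)
  have hc (n : ℕ) : 0 < c n := by simp only [c]; positivity
  have hctop : Tendsto c atTop atTop :=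
    tendsto_natCast_atTop_atTop.comp (tendsto_add_atTop_nat (N + 1))
  have hmeas (n : ℕ) : ∃ μ : Measure (EuclideanSpace ℝ (Fin d)), IsProbabilityMeasure μ ∧
      ∀ t, charFun μ t = (A (c n) 0)⁻¹ * A (c n) ((2 * Real.pi)⁻¹ • t) := by
    let W (w : EuclideanSpace ℝ (Fin d)) : ℝ := Real.exp (-(c n)⁻¹ * ‖w‖ ^ 2) * (𝓕 F w).re
    have hWm : Continuous W := by fun_prop
    have hW0 (w) : 0 ≤ W w := mul_nonneg (Real.exp_pos _).le (Complex.nonneg_iff.1 (hpos w)).1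
    have hWi : Integrable W :=
      (integrable_exp_neg_mul_sq_norm (inv_pos.2 (hc n))).mul_bdd (c := ∫ v, ‖F v‖)
        (by fun_prop) (ae_of_all _ fun w ↦ (Complex.abs_re_le_norm _).trans
          (VectorFourier.norm_fourierIntegral_le_integral_norm _ _ _ _ _))
    have hWA : ((∫ w, W w : ℝ) : ℂ) = A (c n) 0 := by
      rw [← integral_complex_ofReal]
      congr with w
      simp only [W, Complex.ofReal_mul, hPre]
      simp
    obtain ⟨μ, hμ, h⟩ := exists_isProbabilityMeasure_integral_eq hWm.measurable hW0 hWi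
      fun h ↦ hN (n + (N + 1)) (by omega) (hWA.symm.trans (by rw [h]; rfl))
    refine ⟨μ, hμ, fun t ↦ ?_⟩
    rw [charFun_apply, h, hWA]
    congr with w
    simp only [W, Complex.ofReal_mul, hPre, Complex.exp_add, inner_smul_left, real_inner_comm t w]
    push_cast
    rw [mul_right_comm]
    congr 3
    simp
    field_simp
  choose μ hμ hμc using hmeas
  obtain ⟨ν, hν, h⟩ := exists_charFun_eq_of_tendsto μ (f := fun t ↦ F ((2 * Real.pi)⁻¹ • t))
    (hF.comp (by fun_prop)).continuousAt fun t ↦ by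
      simp_rw [hμc]
      simpa [hF0] using (((hA 0).comp hctop).inv₀ (by simp [hF0])).mul ((hA _).comp hctop)
  exact ⟨ν, hν, congrFun h⟩

/-- **Bochner's theorem**: a positive semi-definite function with value `1` at the origin is the
characteristic function of a probability measure. -/
theorem exists_charFun_eq (hf : IsPositiveSemidefinite f) (hf0 : f 0 = 1) :
    ∃ ν : Measure (EuclideanSpace ℝ (Fin d)), IsProbabilityMeasure ν ∧ charFun ν = f := by
  -- Cancels the factor `(2π)⁻¹` between `𝓕` and `charFun`.
  set g := fun x ↦ f ((2 * Real.pi) • x) with hg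
  have hgp : IsPositiveSemidefinite g := hf.comp_smul _
  have (n : ℕ) := exists_charFun_eq_of_fourier_nonneg
    (F := fun u ↦ (Real.exp (-(1 / ((n : ℝ) + 1)) * ‖u‖ ^ 2) : ℂ) * g u)
    (by have := hgp.continuous; fun_prop) (hgp.integrable_gaussian_mul (by positivity))
    (by simp [hg, hf0]) (hgp.fourier_gaussian_mul_nonneg (by positivity))
  choose μ hμ hμc using this
  refine exists_charFun_eq_of_tendsto μ hf.continuous.continuousAt fun t ↦ ?_
  simp_rw [hμc]
  have h1 : g ((2 * Real.pi)⁻¹ • t) = f t := by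
    rw [hg]
    exact congrArg f (smul_inv_smul₀ (by positivity) t)
  rw [h1]
  have h2 : Tendsto (fun n : ℕ ↦ Real.exp (-(1 / ((n : ℝ) + 1)) * ‖(2 * Real.pi)⁻¹ • t‖ ^ 2))
      atTop (𝓝 1) := by
    have := (tendsto_one_div_add_atTop_nhds_zero_nat (𝕜 := ℝ)).neg.mul_const
      (‖(2 * Real.pi)⁻¹ • t‖ ^ 2)
    simpa [Function.comp_def] using (Real.continuous_exp.tendsto _).comp this
  simpa using ((Complex.continuous_ofReal.tendsto _).comp h2).mul_const (f t)

end IsPositiveSemidefinite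

/-! ### Fourier transforms of probability measures -/

section measureFourier

variable {d : ℕ} (μ : Measure (EuclideanSpace ℝ (Fin d)))

theorem measureFourier_eq_charFun (ξ : EuclideanSpace ℝ (Fin d)) :
    measureFourier μ ξ = charFun μ ((-2 * Real.pi) • ξ) := by
  rw [measureFourier, charFun_apply]
  congr with x
  rw [inner_smul_right]
  push_cast
  ring_nf

variable [IsProbabilityMeasure μ]

theorem continuous_measureFourier : Continuous (measureFourier μ) := by
  simp_rw [funext (measureFourier_eq_charFun μ)]
  exact continuous_charFun.comp (by fun_prop)

theorem measureFourier_zero : measureFourier μ 0 = 1 := by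
  simp [measureFourier_eq_charFun]

theorem norm_measureFourier_le_one (ξ : EuclideanSpace ℝ (Fin d)) : ‖measureFourier μ ξ‖ ≤ 1 := by
  rw [measureFourier_eq_charFun]
  exact norm_charFun_le_one _

theorem measureFourier_conv (ν : Measure (EuclideanSpace ℝ (Fin d))) [IsProbabilityMeasure ν]
    (ξ : EuclideanSpace ℝ (Fin d)) :
    measureFourier (μ.conv ν) ξ = measureFourier μ ξ * measureFourier ν ξ := by
  simp only [measureFourier_eq_charFun]
  exact charFun_conv _

theorem isPositiveSemidefinite_measureFourier : IsPositiveSemidefinite (measureFourier μ) where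
  continuous := continuous_measureFourier μ
  nonneg n x _ α := by
    let e (i : Fin n) (y : EuclideanSpace ℝ (Fin d)) : ℂ :=
      Complex.exp (-2 * Real.pi * Complex.I * (inner ℝ y (x i) : ℝ))
    have he (i j : Fin n) (y : EuclideanSpace ℝ (Fin d)) :
        Complex.exp (-2 * Real.pi * Complex.I * (inner ℝ y (x i - x j) : ℝ)) =
          e i y * star (e j y) := by
      simp only [e, Complex.star_def]
      rw [← Complex.exp_conj, ← Complex.exp_add, inner_sub_right]
      congr 1
      simp [Complex.conj_ofNat]
      ring
    have hint (i j : Fin n) :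
        Integrable (fun y ↦ α i * star (α j) * (e i y * star (e j y))) μ := by
      simp_rw [← he]
      refine .const_mul (.of_bound (by fun_prop) 1 (ae_of_all _ fun y ↦ ?_)) _
      simp [Complex.norm_exp]
    -- The form is the integral of `|∑ αᵢ eᵢ|²`.
    have : ∑ i, ∑ j, α i * star (α j) * measureFourier μ (x i - x j) =
        ∫ y, (∑ i, α i * e i y) * star (∑ i, α i * e i y) ∂μ := by
      simp_rw [measureFourier, he, ← integral_const_mul]
      simp_rw [← integral_finsetSum _ fun j _ ↦ hint _ j]
      rw [← integral_finsetSum _ fun i _ ↦ integrable_finsetSum _ fun j _ ↦ hint i j]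
      congr with y
      simp_rw [star_sum, Finset.sum_mul_sum, star_mul']
      refine Finset.sum_congr rfl fun i _ ↦ Finset.sum_congr rfl fun j _ ↦ ?_
      ring
    rw [this]
    exact integral_nonneg fun y ↦ mul_star_self_nonneg _

theorem isInverseFourier_measureFourier : IsInverseFourier μ (measureFourier μ) := by
  have hg : MemLp (measureFourier μ) ∞ (volume : Measure (EuclideanSpace ℝ (Fin d))) :=
    memLp_top_of_bound (continuous_measureFourier μ).aestronglyMeasurable 1
      (ae_of_all _ (norm_measureFourier_le_one μ))
  refine ⟨hg, ?_⟩
  ext φ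
  change ∫ x, φ x ∂μ = _
  rw [TemperedDistribution.fourierInv_apply,
    Lp.toTemperedDistribution_apply]
  have h1 : ∫ ξ, (𝓕⁻ φ) ξ • (hg.toLp (measureFourier μ)) ξ =
      ∫ ξ, (𝓕⁻ φ) ξ • measureFourier μ ξ := by
    refine integral_congr_ae ?_
    filter_upwards [hg.coeFn_toLp] with ξ hξ
    rw [hξ]
  rw [h1]
  -- Fubini duality between `𝓕⁻ φ` under Lebesgue measure and the constant `1` under `μ`.
  have h2 := VectorFourier.integral_fourierIntegral_smul_eq_flip
    (L := innerₗ (EuclideanSpace ℝ (Fin d))) (μ := volume) (ν := μ) (f := ⇑(𝓕⁻ φ : 𝓢(EuclideanSpace ℝ (Fin d), ℂ)))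
    (g := fun _ ↦ (1 : ℂ)) Real.continuous_fourierChar continuous_inner
    (SchwartzMap.integrable _) (integrable_const _)
  rw [flip_innerₗ] at h2
  have h3 (x) : VectorFourier.fourierIntegral Real.fourierChar volume
      (innerₗ (EuclideanSpace ℝ (Fin d)))
      ⇑(𝓕⁻ φ : 𝓢(EuclideanSpace ℝ (Fin d), ℂ)) x = φ x := by
    change 𝓕 (⇑(𝓕⁻ φ : 𝓢(EuclideanSpace ℝ (Fin d), ℂ))) x = φ x
    rw [← SchwartzMap.fourier_coe, FourierTransform.fourier_fourierInv_eq]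
  have h4 (ξ) : VectorFourier.fourierIntegral Real.fourierChar μ
      (innerₗ (EuclideanSpace ℝ (Fin d))) (fun _ ↦ (1 : ℂ)) ξ = measureFourier μ ξ := by
    rw [VectorFourier.fourierIntegral, measureFourier]
    congr with x
    rw [Circle.smul_def, Real.fourierChar_apply]
    simp
    ring_nf
  simpa only [h3, h4, smul_eq_mul, mul_one] using h2

end measureFourier

/-! ### Gaussian deconvolution -/

instance isProbabilityMeasure_gaussianNoise (d : ℕ) (σ : ℝ) :
    IsProbabilityMeasure (gaussianNoise d σ) := by
  unfold gaussianNoise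
  infer_instance

theorem measureFourier_gaussianNoise_ne_zero (d : ℕ) (σ : ℝ) (ξ : EuclideanSpace ℝ (Fin d)) :
    measureFourier (gaussianNoise d σ) ξ ≠ 0 := by
  rw [measureFourier_eq_charFun, gaussianNoise,
    charFun_multivariateGaussian (Matrix.PosSemidef.one.smul (sq_nonneg σ))]
  exact Complex.exp_ne_zero _

theorem fourierRatio_conv_gaussianNoise {d : ℕ} (σ : ℝ) (q : Measure (EuclideanSpace ℝ (Fin d)))
    [IsProbabilityMeasure q] :
    fourierRatio (q.conv (gaussianNoise d σ)) σ = measureFourier q := by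
  ext ξ
  rw [fourierRatio, measureFourier_conv,
    mul_div_cancel_right₀ _ (measureFourier_gaussianNoise_ne_zero d σ ξ)]

theorem exists_conv_gaussianNoise_eq {d : ℕ} {σ : ℝ} {qt : Measure (EuclideanSpace ℝ (Fin d))}
    [IsProbabilityMeasure qt] (h : IsPositiveSemidefinite (fourierRatio qt σ)) :
    ∃ q : Measure (EuclideanSpace ℝ (Fin d)),
      IsProbabilityMeasure q ∧ q.conv (gaussianNoise d σ) = qt := by
  obtain ⟨q, hq, hqc⟩ := (h.comp_smul (-2 * Real.pi)⁻¹).exists_charFun_eq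
    (by simp [fourierRatio, measureFourier_zero])
  have hpi : (-2 * Real.pi) ≠ 0 := by simp [Real.pi_ne_zero]
  refine ⟨q, hq, Measure.ext_of_charFun (funext fun t ↦ ?_)⟩
  have hN := measureFourier_gaussianNoise_ne_zero d σ ((-2 * Real.pi)⁻¹ • t)
  rw [charFun_conv, hqc]
  simp only [fourierRatio, measureFourier_eq_charFun, smul_inv_smul₀ hpi] at hN ⊢
  exact div_mul_cancel₀ _ hN

theorem mainTheorem4 (d : ℕ) (σ : ℝ) (hσ : 0 < σ)
    (qt : Measure (EuclideanSpace ℝ (Fin d))) [IsProbabilityMeasure qt] :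
    ((∃ q : Measure (EuclideanSpace ℝ (Fin d)),
        IsProbabilityMeasure q ∧ q.conv (gaussianNoise d σ) = qt) ↔
      IsPositiveSemidefinite (fourierRatio qt σ)) ∧
    (∀ (q : Measure (EuclideanSpace ℝ (Fin d))) [IsProbabilityMeasure q],
      q.conv (gaussianNoise d σ) = qt → IsInverseFourier q (fourierRatio qt σ)) := by
  refine ⟨⟨?_, exists_conv_gaussianNoise_eq⟩, ?_⟩
  · rintro ⟨q, _, rfl⟩
    rw [fourierRatio_conv_gaussianNoise]
    exact isPositiveSemidefinite_measureFourier q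
  · rintro q _ rfl
    rw [fourierRatio_conv_gaussianNoise]
    exact isInverseFourier_measureFourier q
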